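/- Let $\alpha,\beta\in\mathbb{R}$. Let $\mathbf{N}[\alpha,\beta]$ be the class of all functions $\varphi:\mathbb{C}\setminus[\alpha,\beta]\to\mathbb{C}$ of the form $$\varphi(\lambda)=\int_{\alpha}^{\beta}\frac{d\sigma(t)}{t-\lambda},$$ where $\sigma$ is a finite nonzero positive Borel measure on $[\alpha,\beta]$, and put $\mathbf{N}^0[\alpha,\beta]:=\mathbf{N}[\alpha,\beta]\cup\{0\}$. Let $\varphi\in\mathbf{N}[\alpha,\beta]$ and let $z\in\mathbb{C}$ with $\operatorname{Im}z>0$. Then there exist real numbers $a^{(1)},a^{(2)}$ and $b>0$ such that the equality $$\varphi(\lambda)=-\frac{1}{a^{(2)}\lambda-a^{(1)}+b^2(\lambda-z)(\lambda-\overline{z})\,\tau(\lambda)}\qquad(\lambda\in\mathbb{C}\setminus[\alpha,\beta])$$ (in which the denominator does not vanish) defines a function $\tau\in\mathbf{N}^0[\alpha,\beta]$; that is, exactly one $\tau\in\mathbf{N}^0[\alpha,\beta]$ satisfies it. -/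

import Mathlib

open scoped ComplexConjugate

/-- The cut plane `ℂ \ [α, β]`, the natural domain of the Markov functions on `[α, β]`. -/
def cutPlane (α β : ℝ) : Set ℂ := (Complex.ofReal '' Set.Icc α β)ᶜ

/-- The class `N[α, β]` of Markov functions: the functions `φ(l) = ∫ dσ(t) / (t - l)` on
`ℂ \ [α, β]`, for a finite nonzero positive Borel measure `σ` carried by `[α, β]`. The zero
function is not in this class; it is adjoined in `markovClassZero`. -/
def markovClass (α β : ℝ) : Set (cutPlane α β → ℂ) :=
  {φ | ∃ σ : MeasureTheory.Measure ℝ, MeasureTheory.IsFiniteMeasure σ ∧ σ ≠ 0 ∧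
    σ (Set.Icc α β)ᶜ = 0 ∧
    ∀ l : cutPlane α β, φ l = ∫ t : ℝ, 1 / ((t : ℂ) - (l : ℂ)) ∂σ}

/-- The class `N⁰[α, β] = N[α, β] ∪ {0}`. -/
def markovClassZero (α β : ℝ) : Set (cutPlane α β → ℂ) := markovClass α β ∪ {0}

/-! Realise `φ` as a resolvent entry `⟪e, (M - l)⁻¹ e⟫`, with `M` multiplication by `t` on `L²(σ)`
and `e = 1`. A Schur complement along `e` gives `-s² / φ(l) = s l - m + ∫ dμ(t)/(t - l)`, where `s`,
`m` are the zeroth and first moments of `σ` and `μ` is a spectral measure of the compression of `M`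
to `eᗮ` (`exists_measure_inv_cauchyTransform`). Splitting off the linear polynomial that
interpolates the last integral at `z` and `conj z` leaves `(l - z)(l - conj z)` times the transform
of `|t - z|⁻² dμ` (`cauchyTransform_interpolation`); this is `τ`. The equation fixes `τ` off `{z,
conj z}`, and continuity does the rest. -/

/-! ### Spectral measures of bounded self-adjoint operators. -/

-- Riesz–Markov for the positive functional `f ↦ Re ⟪v, f(T) v⟫` on the compact spectrum, pushed
-- forward to `ℝ`.
open MeasureTheory ContinuousLinearMap in
open scoped InnerProductSpace in
theorem exists_measure_integral_eq_inner_cfc {H : Type*} [NormedAddCommGroup H]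
    [InnerProductSpace ℂ H] [CompleteSpace H] {T : H →L[ℂ] H} (hT : IsSelfAdjoint T)
    {s : Set ℝ} (hs : spectrum ℝ T ⊆ s) (v : H) :
    ∃ μ : Measure ℝ, IsFiniteMeasure μ ∧ μ sᶜ = 0 ∧
      ∀ f : ℝ → ℝ, ContinuousOn f s → ((∫ t, f t ∂μ : ℝ) : ℂ) = ⟪v, cfc f T v⟫_ℂ := by
  have hreal (S : H →L[ℂ] H) (hS : IsSelfAdjoint S) :
      (((⟪v, S v⟫_ℂ).re : ℝ) : ℂ) = ⟪v, S v⟫_ℂ := by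
    rw [← Complex.conj_eq_iff_re, inner_conj_symm]
    exact hS.isSymmetric v v
  have hcompact : CompactSpace (spectrum ℝ T) :=
    isCompact_iff_compactSpace.mp (spectrum.isCompact T)
  let Λ : CompactlySupportedContinuousMap (spectrum ℝ T) ℝ →ₚ[ℝ] ℝ := PositiveLinearMap.mk₀
    { toFun := fun f => (⟪v, cfcHom (R := ℝ) hT f.toContinuousMap v⟫_ℂ).re
      map_add' := fun f g => by
        have : (f + g).toContinuousMap = f.toContinuousMap + g.toContinuousMap := rfl
        simp [this]
      map_smul' := fun c f => by
        have : (c • f).toContinuousMap = c • f.toContinuousMap := rfl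
        rw [this, map_smul]
        simp [inner_smul_right_eq_smul] }
    (fun f hf => by
      have h : 0 ≤ cfcHom (R := ℝ) hT f.toContinuousMap := (cfcHom_nonneg_iff hT).mpr fun x => hf x
      exact ((nonneg_iff_isPositive _).mp h).re_inner_nonneg_right v)
  have hemb : MeasurableEmbedding ((↑) : spectrum ℝ T → ℝ) :=
    MeasurableEmbedding.subtype_coe (spectrum.isCompact (𝕜 := ℝ) T).measurableSet
  refine ⟨(RealRMK.rieszMeasure Λ).map (↑), ?_, ?_, fun f hf => ?_⟩
  · have : IsFiniteMeasure (RealRMK.rieszMeasure Λ) :=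
      ⟨by
        refine (RealRMK.rieszMeasure_le_of_eq_one Λ
          (f := CompactlySupportedContinuousMap.continuousMapEquiv 1) (fun _ => zero_le_one)
          isCompact_univ fun _ _ => rfl).trans_lt ENNReal.ofReal_lt_top⟩
    infer_instance
  · rw [hemb.map_apply]
    have : ((↑) : spectrum ℝ T → ℝ) ⁻¹' sᶜ = ∅ := by
      ext x
      simpa using hs x.2
    simp [this]
  · have hf' := hf.mono hs
    rw [hemb.integral_map, cfc_apply f T hT hf', ← hreal _ (cfcHom_predicate (R := ℝ) hT _)]
    congr 1
    exact RealRMK.integral_rieszMeasure Λ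
      (CompactlySupportedContinuousMap.continuousMapEquiv ⟨_, hf'.domRestrict⟩)

theorem continuousOn_one_div_ofReal_sub {α β : ℝ} {l : ℂ} (hl : l ∈ cutPlane α β) :
    ContinuousOn (fun t : ℝ => 1 / ((t : ℂ) - l)) (Set.Icc α β) := by
  refine ContinuousOn.div (by fun_prop) (by fun_prop) fun t ht h => hl ⟨t, ht, ?_⟩
  exact sub_eq_zero.mp h

theorem MeasureTheory.Integrable.of_continuousOn_Icc {E : Type*} [NormedAddCommGroup E]
    {α β : ℝ} {μ : Measure ℝ} [IsFiniteMeasure μ] (hμ : μ (Set.Icc α β)ᶜ = 0) {f : ℝ → E}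
    (hf : ContinuousOn f (Set.Icc α β)) : Integrable f μ := by
  rw [← Measure.restrict_eq_self_of_ae_mem (s := Set.Icc α β) (μ := μ) hμ]
  exact hf.integrableOn_compact isCompact_Icc

-- The functional calculus used is real, so the kernel is split as `g + i k`; the real and imaginary
-- parts of `(g + i k)(t - l) = 1` show that `g(T) + i k(T)` inverts `T - l`.
open MeasureTheory ContinuousLinearMap in
open scoped InnerProductSpace in
theorem exists_measure_integral_eq_inner_resolvent {H : Type*} [NormedAddCommGroup H]
    [InnerProductSpace ℂ H] [CompleteSpace H] {T : H →L[ℂ] H} (hT : IsSelfAdjoint T)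
    {α β : ℝ} (hs : spectrum ℝ T ⊆ Set.Icc α β) (v : H) :
    ∃ μ : Measure ℝ, IsFiniteMeasure μ ∧ μ (Set.Icc α β)ᶜ = 0 ∧
      ∀ l ∈ cutPlane α β, ∀ w : H, T w - l • w = v →
        ∫ t : ℝ, 1 / ((t : ℂ) - l) ∂μ = ⟪v, w⟫_ℂ := by
  obtain ⟨μ, hfin, hμ, h⟩ := exists_measure_integral_eq_inner_cfc hT hs v
  refine ⟨μ, hfin, hμ, fun l hl w hw => ?_⟩
  have hc := continuousOn_one_div_ofReal_sub hl
  have hre : ContinuousOn (fun t : ℝ => (1 / ((t : ℂ) - l)).re) (Set.Icc α β) :=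
    Complex.continuous_re.comp_continuousOn hc
  have him : ContinuousOn (fun t : ℝ => (1 / ((t : ℂ) - l)).im) (Set.Icc α β) :=
    Complex.continuous_im.comp_continuousOn hc
  set g : ℝ → ℝ := fun t => (1 / ((t : ℂ) - l)).re with hg
  set k : ℝ → ℝ := fun t => (1 / ((t : ℂ) - l)).im with hk
  have key (t : ℝ) (ht : t ∈ Set.Icc α β) :
      g t * (t - l.re) + k t * l.im = 1 ∧ k t * (t - l.re) - g t * l.im = 0 := by
    have hne : (t : ℂ) - l ≠ 0 := fun h0 => hl ⟨t, ht, sub_eq_zero.mp h0⟩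
    have h1 : (1 / ((t : ℂ) - l)) * ((t : ℂ) - l) = 1 := one_div_mul_cancel hne
    have h2 := congrArg Complex.re h1
    have h3 := congrArg Complex.im h1
    rw [Complex.mul_re] at h2
    rw [Complex.mul_im] at h3
    simp only [Complex.sub_re, Complex.sub_im, Complex.ofReal_re, Complex.ofReal_im,
      Complex.one_re, Complex.one_im] at h2 h3
    exact ⟨by linarith, by linarith⟩
  have hmul (f : ℝ → ℝ) (hf : ContinuousOn f (Set.Icc α β)) :
      cfc (fun t => f t * (t - l.re)) T = cfc f T * (T - algebraMap ℝ (H →L[ℂ] H) l.re) := by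
    rw [cfc_mul f (fun t => t - l.re) T (hf.mono hs) (by fun_prop),
      cfc_sub (fun t : ℝ => t) (fun _ => l.re) T (by fun_prop) (by fun_prop), cfc_id' ℝ T,
      cfc_const l.re T]
  have e1 : cfc g T * (T - algebraMap ℝ (H →L[ℂ] H) l.re) + l.im • cfc k T = 1 := by
    rw [← hmul g hre, ← cfc_smul l.im k T (him.mono hs), ← cfc_add T (fun t => g t * (t - l.re)) (fun t => l.im • k t)
      ((hre.mul (by fun_prop)).mono hs) ((him.const_smul l.im).mono hs), ← cfc_const_one ℝ T]
    exact cfc_congr fun t ht => by simpa [mul_comm] using (key t (hs ht)).1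
  have e2 : cfc k T * (T - algebraMap ℝ (H →L[ℂ] H) l.re) - l.im • cfc g T = 0 := by
    rw [← hmul k him, ← cfc_smul l.im g T (hre.mono hs), ← cfc_sub (fun t => k t * (t - l.re)) (fun t => l.im • g t) T
      ((him.mul (by fun_prop)).mono hs) ((hre.const_smul l.im).mono hs), ← cfc_const_zero ℝ T]
    exact cfc_congr fun t ht => by simpa [mul_comm] using (key t (hs ht)).2
  have e : cfc g T v + Complex.I • cfc k T v = w := by
    have e1' := congrArg (fun S : H →L[ℂ] H => S w) e1
    have e2' := congrArg (fun S : H →L[ℂ] H => S w) e2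
    simp only [add_apply, sub_apply, mul_apply_eq_comp, smul_apply, one_apply_eq_self,
      Algebra.algebraMap_eq_smul_one, map_sub, zero_apply, map_smul_of_tower] at e1' e2'
    rw [← Complex.coe_smul, ← Complex.coe_smul] at e1' e2'
    rw [← hw, map_sub, map_sub, map_smul, map_smul]
    nth_rw 1 2 [← Complex.re_add_im l]
    have := congr($e1' + Complex.I • $e2')
    rw [smul_zero, add_zero] at this
    refine Eq.trans ?_ this
    have hI := Complex.I_mul_I
    match_scalars <;> first | ring1 | linear_combination -(l.im : ℂ) * hI
  rw [← e, inner_add_right, inner_smul_right, ← h g hre, ← h k him]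
  have hi := Integrable.of_continuousOn_Icc hμ hc
  rw [← integral_re_add_im hi, mul_comm]
  rfl

/-! ### Numerical range and the Schur complement. -/

open ContinuousLinearMap in
open scoped InnerProductSpace in
theorem spectrum_subset_Icc_of_inner_bounds {H : Type*} [NormedAddCommGroup H]
    [InnerProductSpace ℂ H] [CompleteSpace H] {T : H →L[ℂ] H} (hT : IsSelfAdjoint T) {α β : ℝ}
    (hα : ∀ x, α * ‖x‖ ^ 2 ≤ (⟪T x, x⟫_ℂ).re) (hβ : ∀ x, (⟪T x, x⟫_ℂ).re ≤ β * ‖x‖ ^ 2) :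
    spectrum ℝ T ⊆ Set.Icc α β := by
  have hc (c : ℝ) : IsSelfAdjoint (algebraMap ℝ (H →L[ℂ] H) c) := cfc_predicate_algebraMap c
  have hre (c : ℝ) (x : H) :
      (⟪algebraMap ℝ (H →L[ℂ] H) c x, x⟫_ℂ).re = c * ‖x‖ ^ 2 := by
    rw [Algebra.algebraMap_eq_smul_one, smul_apply, one_apply_eq_self, ← Complex.coe_smul,
      inner_smul_left, Complex.conj_ofReal, Complex.re_ofReal_mul, inner_self_eq_norm_sq_to_K]
    norm_cast
  have h1 : algebraMap ℝ (H →L[ℂ] H) α ≤ T := by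
    rw [le_def, isPositive_def']
    refine ⟨hT.sub (hc α), fun x => ?_⟩
    rw [reApplyInnerSelf_apply, sub_apply, inner_sub_left, map_sub]
    exact sub_nonneg.mpr ((hre α x).trans_le (hα x))
  have h2 : T ≤ algebraMap ℝ (H →L[ℂ] H) β := by
    rw [le_def, isPositive_def']
    refine ⟨(hc β).sub hT, fun x => ?_⟩
    rw [reApplyInnerSelf_apply, sub_apply, inner_sub_left, map_sub]
    exact sub_nonneg.mpr ((hβ x).trans_eq (hre β x).symm)
  exact fun x hx => ⟨(algebraMap_le_iff_le_spectrum hT).mp h1 x hx,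
    (le_algebraMap_iff_spectrum_le hT).mp h2 x hx⟩

-- Vanishing would make `l` equal to the Rayleigh quotient of `r`, which lies in `[α, β]`.
open scoped InnerProductSpace in
theorem inner_resolvent_ne_zero {H : Type*} [NormedAddCommGroup H]
    [InnerProductSpace ℂ H] [CompleteSpace H] {M : H →L[ℂ] H} (hM : IsSelfAdjoint M) {α β : ℝ}
    (hα : ∀ x, α * ‖x‖ ^ 2 ≤ (⟪M x, x⟫_ℂ).re) (hβ : ∀ x, (⟪M x, x⟫_ℂ).re ≤ β * ‖x‖ ^ 2)
    {l : ℂ} (hl : l ∈ cutPlane α β) {r : H} (hr : r ≠ 0) : ⟪M r - l • r, r⟫_ℂ ≠ 0 := by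
  intro h
  have hpos : 0 < ‖r‖ ^ 2 := by positivity
  have hreal : (((⟪M r, r⟫_ℂ).re : ℝ) : ℂ) = ⟪M r, r⟫_ℂ := by
    rw [← Complex.conj_eq_iff_re, inner_conj_symm]
    exact (hM.isSymmetric r r).symm
  rw [inner_sub_left, inner_smul_left, inner_self_eq_norm_sq_to_K, ← hreal, sub_eq_zero] at h
  have hl' := congrArg conj h
  simp only [map_mul, Complex.conj_conj, Complex.conj_ofReal, map_pow, Complex.coe_algebraMap] at hl'
  refine hl ⟨(⟪M r, r⟫_ℂ).re / ‖r‖ ^ 2, ⟨?_, ?_⟩, ?_⟩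
  · rw [le_div_iff₀ hpos]; exact hα r
  · rw [div_le_iff₀ hpos]; exact hβ r
  · have : (‖r‖ : ℂ) ^ 2 ≠ 0 := by exact_mod_cast hpos.ne'
    push_cast
    rw [div_eq_iff this]
    exact hl'

open MeasureTheory ContinuousLinearMap in
open scoped InnerProductSpace in
theorem exists_measure_inv_inner_resolvent {H : Type*} [NormedAddCommGroup H]
    [InnerProductSpace ℂ H] [CompleteSpace H] {M : H →L[ℂ] H} (hM : IsSelfAdjoint M) {α β : ℝ}
    (hα : ∀ x, α * ‖x‖ ^ 2 ≤ (⟪M x, x⟫_ℂ).re) (hβ : ∀ x, (⟪M x, x⟫_ℂ).re ≤ β * ‖x‖ ^ 2)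
    {e : H} (he : e ≠ 0) :
    ∃ μ : Measure ℝ, IsFiniteMeasure μ ∧ μ (Set.Icc α β)ᶜ = 0 ∧
      ∀ l ∈ cutPlane α β, ∀ r : H, M r - l • r = e → ⟪e, r⟫_ℂ ≠ 0 ∧
        (∫ t : ℝ, 1 / ((t : ℂ) - l) ∂μ) * ⟪e, r⟫_ℂ =
          -⟪e, e⟫_ℂ ^ 2 - (l * ⟪e, e⟫_ℂ - ⟪e, M e⟫_ℂ) * ⟪e, r⟫_ℂ := by
  have hs : ⟪e, e⟫_ℂ ≠ 0 := inner_self_ne_zero.mpr he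
  have hαβ : α ≤ β := le_of_mul_le_mul_right ((hα e).trans (hβ e)) (by positivity)
  set P : H →L[ℂ] H := (ℂ ∙ e)ᗮ.starProjection with hP
  have hPsa : IsSelfAdjoint P := isSelfAdjoint_starProjection _
  have hPsym (x y : H) : ⟪P x, y⟫_ℂ = ⟪x, P y⟫_ℂ := hPsa.isSymmetric x y
  have hPx (x : H) : P x = x - (⟪e, x⟫_ℂ / ⟪e, e⟫_ℂ) • e := by
    rw [inner_self_eq_norm_sq_to_K, hP, Submodule.starProjection_orthogonal_val,
      Submodule.starProjection_singleton]
    norm_cast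
  have hPe : P e = 0 := by rw [hPx, div_self hs, one_smul, sub_self]
  have hPP (x : H) : P (P x) = P x := by
    rw [congrArg P (hPx x), map_sub, map_smul, hPe, smul_zero, sub_zero]
  -- `P M P` alone would put `0` in the spectrum; the value `α` on the span of `e` keeps it inside
  -- `[α, β]`.
  set T : H →L[ℂ] H := P * M * P + α • (1 - P) with hT
  have hTsa : IsSelfAdjoint T := by
    have h1 : IsSelfAdjoint (P * M * P) := by simpa [hPsa.star_eq] using hM.conjugate P
    have h2 : IsSelfAdjoint (1 - P) := (IsSelfAdjoint.one (H →L[ℂ] H)).sub hPsa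
    exact h1.add ((IsSelfAdjoint.all α).smul h2)
  have hTx (x : H) : (⟪T x, x⟫_ℂ).re = (⟪M (P x), P x⟫_ℂ).re + α * ‖x - P x‖ ^ 2 := by
    have h1 : ⟪x - P x, x⟫_ℂ = ⟪x - P x, x - P x⟫_ℂ := by
      rw [inner_sub_right (x - P x), inner_sub_left x (P x) (P x), hPsym x (P x), hPP, sub_self,
        sub_zero]
    have h2 : T x = P (M (P x)) + (α : ℂ) • (x - P x) := by simp [hT]
    rw [h2, inner_add_left, hPsym, inner_smul_left, h1, inner_self_eq_norm_sq_to_K,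
      Complex.conj_ofReal, Complex.add_re, Complex.re_ofReal_mul]
    norm_cast
  have hnorm (x : H) : ‖x‖ ^ 2 = ‖P x‖ ^ 2 + ‖x - P x‖ ^ 2 := by
    have h1 : ⟪P x, x - P x⟫_ℂ = 0 := by rw [hPsym, map_sub, hPP, sub_self, inner_zero_right]
    have h2 := norm_add_sq_eq_norm_sq_add_norm_sq_of_inner_eq_zero _ _ h1
    rw [add_sub_cancel] at h2
    linarith
  have hspec : spectrum ℝ T ⊆ Set.Icc α β := by
    refine spectrum_subset_Icc_of_inner_bounds hTsa (fun x => ?_) fun x => ?_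
    · rw [hTx, hnorm x]
      linarith [hα (P x)]
    · rw [hTx, hnorm x]
      have := mul_le_mul_of_nonneg_right hαβ (sq_nonneg ‖x - P x‖)
      linarith [hβ (P x)]
  obtain ⟨μ, hfin, hμ, h⟩ := exists_measure_integral_eq_inner_resolvent hTsa hspec (P (M e))
  refine ⟨μ, hfin, hμ, fun l hl r hr => ?_⟩
  have hφ : ⟪e, r⟫_ℂ ≠ 0 := by
    have : r ≠ 0 := by
      rintro rfl
      simp at hr
      exact he hr.symm
    rw [← hr]
    exact inner_resolvent_ne_zero hM hα hβ hl this
  refine ⟨hφ, ?_⟩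
  have hMr : M r = e + l • r := by rw [← hr]; abel
  -- Projecting `M r - l r = e` to `eᗮ` kills `e`, so `P r` is, up to a scalar, the resolvent of `T`
  -- applied to `P (M e)`.
  have hTw : T (P r) - l • P r = (-(⟪e, r⟫_ℂ / ⟪e, e⟫_ℂ)) • P (M e) := by
    have h1 : T (P r) = P (M (P r)) := by simp [hT, hPP]
    rw [h1]
    nth_rw 1 [hPx r]
    rw [map_sub, map_smul, hMr, map_sub, map_add, map_smul, map_smul, hPe]
    module
  have hw : T ((-(⟪e, e⟫_ℂ / ⟪e, r⟫_ℂ)) • P r) - l • ((-(⟪e, e⟫_ℂ / ⟪e, r⟫_ℂ)) • P r)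
      = P (M e) := by
    rw [map_smul, smul_comm l, ← smul_sub, hTw, smul_smul]
    field_simp
    simp
  have hMsym : ⟪M e, r⟫_ℂ = ⟪e, e⟫_ℂ + l * ⟪e, r⟫_ℂ := by
    rw [show ⟪M e, r⟫_ℂ = ⟪e, M r⟫_ℂ from hM.isSymmetric e r, hMr, inner_add_right,
      inner_smul_right]
  have hMe : ⟪M e, e⟫_ℂ = ⟪e, M e⟫_ℂ := hM.isSymmetric e e
  rw [h l hl _ hw, inner_smul_right, hPsym, hPP, hPx r, inner_sub_right, inner_smul_right, hMsym,
    hMe]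
  field_simp
  ring

/-! ### The multiplication operator on `L²(σ)`. -/

open MeasureTheory in
open scoped InnerProductSpace ENNReal in
theorem exists_measure_inv_cauchyTransform {α β : ℝ} {σ : Measure ℝ} [IsFiniteMeasure σ]
    (hσ0 : σ ≠ 0) (hσ : σ (Set.Icc α β)ᶜ = 0) :
    ∃ μ : Measure ℝ, IsFiniteMeasure μ ∧ μ (Set.Icc α β)ᶜ = 0 ∧
      ∀ l ∈ cutPlane α β, ∫ t : ℝ, 1 / ((t : ℂ) - l) ∂σ ≠ 0 ∧
        (∫ t : ℝ, 1 / ((t : ℂ) - l) ∂μ) * ∫ t : ℝ, 1 / ((t : ℂ) - l) ∂σ =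
          -(σ.real Set.univ : ℂ) ^ 2 - (l * (σ.real Set.univ : ℂ) - ((∫ t, t ∂σ : ℝ) : ℂ)) *
            ∫ t : ℝ, 1 / ((t : ℂ) - l) ∂σ := by
  have hmem : ∀ᵐ t ∂σ, t ∈ Set.Icc α β := hσ
  have hbdd {f : ℝ → ℂ} (hf : ContinuousOn f (Set.Icc α β)) (p : ℝ≥0∞) : MemLp f p σ := by
    obtain ⟨C, hC⟩ := isCompact_Icc.exists_bound_of_continuousOn hf
    exact MemLp.of_bound (Integrable.of_continuousOn_Icc hσ hf).aestronglyMeasurable C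
      (hmem.mono fun t ht => hC t ht)
  have hid : ContinuousOn (fun t : ℝ => (t : ℂ)) (Set.Icc α β) := by fun_prop
  have hone : ContinuousOn (fun _ : ℝ => (1 : ℂ)) (Set.Icc α β) := by fun_prop
  let M : Lp ℂ 2 σ →L[ℂ] Lp ℂ 2 σ :=
    (ContinuousLinearMap.mul ℂ ℂ).holderL σ ∞ 2 2 ((hbdd hid ∞).toLp _)
  have hM (f : Lp ℂ 2 σ) : M f =ᵐ[σ] fun t => (t : ℂ) * f t := by
    have h1 : M f = (ContinuousLinearMap.mul ℂ ℂ).holder 2 ((hbdd hid ∞).toLp _) f := rfl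
    rw [h1]
    filter_upwards [(ContinuousLinearMap.mul ℂ ℂ).coeFn_holder (r := 2) ((hbdd hid ∞).toLp _) f,
      (hbdd hid ∞).coeFn_toLp] with t ht ht'
    rw [ht, ht']
    rfl
  have hMsa : IsSelfAdjoint M := by
    rw [ContinuousLinearMap.isSelfAdjoint_iff_isSymmetric]
    intro f g
    change ⟪M f, g⟫_ℂ = ⟪f, M g⟫_ℂ
    rw [L2.inner_def, L2.inner_def]
    refine integral_congr_ae ?_
    filter_upwards [hM f, hM g] with t hf hg
    rw [hf, hg]
    simp only [RCLike.inner_apply, map_mul, Complex.conj_ofReal]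
    ring
  have hnorm (f : Lp ℂ 2 σ) : ‖f‖ ^ 2 = ∫ t, ‖f t‖ ^ 2 ∂σ := by
    have h1 : ((‖f‖ ^ 2 : ℝ) : ℂ) = ((∫ t, ‖f t‖ ^ 2 ∂σ : ℝ) : ℂ) := by
      rw [← integral_complex_ofReal]
      have := inner_self_eq_norm_sq_to_K (𝕜 := ℂ) f
      push_cast
      rw [← Complex.coe_algebraMap, ← this, L2.inner_def]
      refine integral_congr_ae (.of_forall fun t => ?_)
      simp
    exact_mod_cast h1
  have hsq (f : Lp ℂ 2 σ) : Integrable (fun t => ‖f t‖ ^ 2) σ :=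
    (Lp.memLp f).integrable_norm_pow (by norm_num)
  have hMint (f : Lp ℂ 2 σ) : (⟪M f, f⟫_ℂ).re = ∫ t, t * ‖f t‖ ^ 2 ∂σ := by
    have h1 : ⟪M f, f⟫_ℂ = ((∫ t, t * ‖f t‖ ^ 2 ∂σ : ℝ) : ℂ) := by
      rw [L2.inner_def, ← integral_complex_ofReal]
      refine integral_congr_ae ?_
      filter_upwards [hM f] with t hf
      have := inner_self_eq_norm_sq_to_K (𝕜 := ℂ) (f t)
      rw [hf, ← smul_eq_mul, inner_smul_left, this]
      simp
    rw [h1, Complex.ofReal_re]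
  have hMsq (f : Lp ℂ 2 σ) : Integrable (fun t => t * ‖f t‖ ^ 2) σ := by
    refine (hsq f).bdd_mul (c := max |α| |β|) (by fun_prop) (hmem.mono fun t ht => ?_)
    exact abs_le_max_abs_abs ht.1 ht.2
  have hα (f : Lp ℂ 2 σ) : α * ‖f‖ ^ 2 ≤ (⟪M f, f⟫_ℂ).re := by
    rw [hnorm, hMint, ← integral_const_mul]
    exact integral_mono_ae ((hsq f).const_mul α) (hMsq f) (hmem.mono fun t ht =>
      mul_le_mul_of_nonneg_right ht.1 (sq_nonneg _))
  have hβ (f : Lp ℂ 2 σ) : (⟪M f, f⟫_ℂ).re ≤ β * ‖f‖ ^ 2 := by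
    rw [hnorm, hMint, ← integral_const_mul]
    exact integral_mono_ae (hMsq f) ((hsq f).const_mul β) (hmem.mono fun t ht =>
      mul_le_mul_of_nonneg_right ht.2 (sq_nonneg _))
  set e : Lp ℂ 2 σ := (hbdd hone 2).toLp _ with he
  have he' : e =ᵐ[σ] fun _ => (1 : ℂ) := (hbdd hone 2).coeFn_toLp
  have hinner (f : Lp ℂ 2 σ) : ⟪e, f⟫_ℂ = ∫ t, f t ∂σ := by
    rw [L2.inner_def]
    refine integral_congr_ae (he'.mono fun t ht => ?_)
    simp only [ht]
    simp
  have hee : ⟪e, e⟫_ℂ = (σ.real Set.univ : ℂ) := by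
    rw [hinner, integral_congr_ae he']
    simp
  have heM : ⟪e, M e⟫_ℂ = ((∫ t, t ∂σ : ℝ) : ℂ) := by
    rw [hinner, ← integral_complex_ofReal]
    refine integral_congr_ae ?_
    filter_upwards [hM e, he'] with t h1 h2
    rw [h1, h2, mul_one]
  have hene : e ≠ 0 := by
    rw [← inner_self_ne_zero (𝕜 := ℂ), hee]
    have : NeZero σ := ⟨hσ0⟩
    exact_mod_cast (measureReal_univ_pos).ne'
  obtain ⟨μ, hfin, hμ, h⟩ := exists_measure_inv_inner_resolvent hMsa hα hβ hene
  refine ⟨μ, hfin, hμ, fun l hl => ?_⟩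
  have hr := hbdd (continuousOn_one_div_ofReal_sub hl) 2
  have hres : M (hr.toLp _) - l • hr.toLp _ = e := by
    refine Lp.ext ?_
    filter_upwards [Lp.coeFn_sub (M (hr.toLp _)) (l • hr.toLp _), Lp.coeFn_smul l (hr.toLp _),
      hM (hr.toLp _), hr.coeFn_toLp, he', hmem] with t h1 h2 h3 h4 h5 h6
    have hne : (t : ℂ) - l ≠ 0 := fun h0 => hl ⟨t, h6, sub_eq_zero.mp h0⟩
    rw [h1, Pi.sub_apply, h2, h3, Pi.smul_apply, h4, h5, smul_eq_mul, ← sub_mul,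
      mul_one_div_cancel hne]
  have := h l hl _ hres
  rwa [hinner, integral_congr_ae hr.coeFn_toLp, hee, heM] at this

/-! ### Continuity and uniqueness in the class `N⁰`. -/

theorem mem_markovClassZero_iff {α β : ℝ} {τ : cutPlane α β → ℂ} :
    τ ∈ markovClassZero α β ↔ ∃ σ : MeasureTheory.Measure ℝ, MeasureTheory.IsFiniteMeasure σ ∧
      σ (Set.Icc α β)ᶜ = 0 ∧ ∀ l : cutPlane α β, τ l = ∫ t : ℝ, 1 / ((t : ℂ) - (l : ℂ)) ∂σ := by
  constructor
  · rintro (⟨σ, hfin, -, hσ, h⟩ | h)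
    · exact ⟨σ, hfin, hσ, h⟩
    · rw [Set.mem_singleton_iff] at h
      exact ⟨0, inferInstance, by simp, fun l => by simp [h]⟩
  · rintro ⟨σ, hfin, hσ, h⟩
    by_cases h0 : σ = 0
    · right
      ext l
      simp [h l, h0]
    · exact Or.inl ⟨σ, hfin, h0, hσ, h⟩

theorem isOpen_cutPlane (α β : ℝ) : IsOpen (cutPlane α β) :=
  (isCompact_Icc.image Complex.continuous_ofReal).isClosed.isOpen_compl

open MeasureTheory in
theorem continuousAt_cauchyTransform {α β : ℝ} {σ : Measure ℝ} [IsFiniteMeasure σ]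
    (hσ : σ (Set.Icc α β)ᶜ = 0) {l₀ : ℂ} (hl₀ : l₀ ∈ cutPlane α β) :
    ContinuousAt (fun l : ℂ => ∫ t : ℝ, 1 / ((t : ℂ) - l) ∂σ) l₀ := by
  have hmem : ∀ᵐ t ∂σ, t ∈ Set.Icc α β := hσ
  obtain ⟨ε, hε, hball⟩ := Metric.isOpen_iff.mp (isOpen_cutPlane α β) l₀ hl₀
  refine continuousAt_of_dominated (bound := fun _ => 2 / ε) (.of_forall fun l => ?_) ?_
    (integrable_const _) ?_
  · exact (by fun_prop : Measurable fun t : ℝ => 1 / ((t : ℂ) - l)).aestronglyMeasurable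
  · filter_upwards [Metric.ball_mem_nhds l₀ (half_pos hε)] with l hl
    filter_upwards [hmem] with t ht
    have h1 : ε ≤ ‖(t : ℂ) - l₀‖ := by
      by_contra! h
      exact hball (mem_ball_iff_norm.mpr h) ⟨t, ht, rfl⟩
    have h2 : ‖l - l₀‖ < ε / 2 := mem_ball_iff_norm.mp hl
    have h3 : ‖(t : ℂ) - l₀‖ ≤ ‖(t : ℂ) - l‖ + ‖l - l₀‖ := norm_sub_le_norm_sub_add_norm_sub _ _ _
    rw [norm_div, norm_one, div_le_div_iff₀ (by linarith) hε]
    linarith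
  · filter_upwards [hmem] with t ht
    have : (t : ℂ) - l₀ ≠ 0 := fun h0 => hl₀ ⟨t, ht, sub_eq_zero.mp h0⟩
    fun_prop (disch := assumption)

theorem markovClassZero_eq_of_eq_off_finite {α β : ℝ} {τ τ' : cutPlane α β → ℂ}
    (hτ : τ ∈ markovClassZero α β) (hτ' : τ' ∈ markovClassZero α β) {s : Set ℂ} (hs : s.Finite)
    (h : ∀ l : cutPlane α β, (l : ℂ) ∉ s → τ l = τ' l) : τ = τ' := by
  obtain ⟨σ, hfin, hσ, hτ⟩ := mem_markovClassZero_iff.mp hτ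
  obtain ⟨σ', hfin', hσ', hτ'⟩ := mem_markovClassZero_iff.mp hτ'
  ext l
  rw [hτ, hτ']
  have h1 := (continuousAt_cauchyTransform hσ l.2).tendsto.mono_left
    (nhdsWithin_le_nhds (s := {(l : ℂ)}ᶜ))
  have h2 := (continuousAt_cauchyTransform hσ' l.2).tendsto.mono_left
    (nhdsWithin_le_nhds (s := {(l : ℂ)}ᶜ))
  refine tendsto_nhds_unique_of_eventuallyEq h1 h2 ?_
  have h3 : ∀ᶠ x in nhdsWithin (l : ℂ) {(l : ℂ)}ᶜ, x ∈ cutPlane α β :=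
    nhdsWithin_le_nhds ((isOpen_cutPlane α β).mem_nhds l.2)
  have h4 : ∀ᶠ x in nhdsWithin (l : ℂ) {(l : ℂ)}ᶜ, x ∉ s := by
    have := (hs.subset (Set.sdiff_subset (t := {(l : ℂ)}))).isClosed.isOpen_compl.mem_nhds
      (x := (l : ℂ)) (by simp)
    filter_upwards [nhdsWithin_le_nhds this, self_mem_nhdsWithin] with x hx hx' hxs
    exact hx ⟨hxs, hx'⟩
  filter_upwards [h3, h4] with x hx hxs
  rw [← hτ ⟨x, hx⟩, ← hτ' ⟨x, hx⟩]
  exact h ⟨x, hx⟩ hxs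

/-! ### Interpolation at `z`, `conj z` and the conclusion. -/

theorem continuous_normSq_ofReal_sub_inv {z : ℂ} (hz : z.im ≠ 0) :
    Continuous fun t : ℝ => (Complex.normSq ((t : ℂ) - z))⁻¹ := by
  refine Continuous.inv₀ (by fun_prop) fun t h => hz ?_
  have := congrArg Complex.im (Complex.normSq_eq_zero.mp h)
  simpa using this

-- Integrate `(t - z)(t - conj z) - (l - z)(l - conj z) = (t - l)(t + l - 2 Re z)` after division by
-- `(t - l)|t - z|²`.
open MeasureTheory in
theorem cauchyTransform_interpolation {α β : ℝ} {μ : Measure ℝ} [IsFiniteMeasure μ]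
    (hμ : μ (Set.Icc α β)ᶜ = 0) {z : ℂ} (hz : z.im ≠ 0) {l : ℂ} (hl : l ∈ cutPlane α β) :
    ∫ t : ℝ, 1 / ((t : ℂ) - l) ∂μ =
      ((∫ t : ℝ, (Complex.normSq ((t : ℂ) - z))⁻¹ ∂μ : ℝ) : ℂ) * l +
      ((∫ t : ℝ, (t - 2 * z.re) * (Complex.normSq ((t : ℂ) - z))⁻¹ ∂μ : ℝ) : ℂ) +
      (l - z) * (l - conj z) *
        ∫ t : ℝ, ((Complex.normSq ((t : ℂ) - z))⁻¹ : ℝ) * (1 / ((t : ℂ) - l)) ∂μ := by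
  have hmem : ∀ᵐ t ∂μ, t ∈ Set.Icc α β := hμ
  have hc := continuous_normSq_ofReal_sub_inv hz
  have i1 : Integrable (fun t : ℝ => (((Complex.normSq ((t : ℂ) - z))⁻¹ : ℝ) : ℂ)) μ :=
    .of_continuousOn_Icc hμ (Complex.continuous_ofReal.comp hc).continuousOn
  have i2 : Integrable (fun t : ℝ =>
      (((t - 2 * z.re) * (Complex.normSq ((t : ℂ) - z))⁻¹ : ℝ) : ℂ)) μ :=
    .of_continuousOn_Icc hμ (by fun_prop)
  have i3 : Integrable (fun t : ℝ =>
      (((Complex.normSq ((t : ℂ) - z))⁻¹ : ℝ) : ℂ) * (1 / ((t : ℂ) - l))) μ :=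
    .of_continuousOn_Icc hμ ((Complex.continuous_ofReal.comp hc).continuousOn.mul
      (continuousOn_one_div_ofReal_sub hl))
  rw [← integral_complex_ofReal, ← integral_complex_ofReal, ← integral_mul_const,
    ← integral_const_mul, ← integral_add (i1.mul_const l) i2]
  refine Eq.trans ?_ (integral_add ((i1.mul_const l).add i2) (i3.const_mul _))
  refine integral_congr_ae (hmem.mono fun t ht => ?_)
  have hne : (t : ℂ) - l ≠ 0 := fun h0 => hl ⟨t, ht, sub_eq_zero.mp h0⟩
  have hz1 : (t : ℂ) - z ≠ 0 := fun h => hz (by simpa using congrArg Complex.im h)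
  have hz2 : (t : ℂ) - conj z ≠ 0 := fun h => hz (by simpa using congrArg Complex.im h)
  have hre : ((2 * z.re : ℝ) : ℂ) = z + conj z := (Complex.add_conj z).symm
  simp only [Complex.ofReal_mul, Complex.ofReal_inv, Complex.normSq_eq_conj_mul_self,
    map_sub, Complex.conj_ofReal, Complex.ofReal_sub] at hre ⊢
  rw [hre]
  field_simp
  ring

open MeasureTheory in
theorem mainTheorem3 (α β : ℝ) (φ : cutPlane α β → ℂ) (hφ : φ ∈ markovClass α β)
    (z : ℂ) (hz : 0 < z.im) :
    ∃ a₁ a₂ b : ℝ, 0 < b ∧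
      ∃! τ : cutPlane α β → ℂ, τ ∈ markovClassZero α β ∧
        ∀ l : cutPlane α β,
          (a₂ : ℂ) * l - a₁ + (b : ℂ) ^ 2 * ((l : ℂ) - z) * ((l : ℂ) - conj z) * τ l ≠ 0 ∧
          φ l = -1 / ((a₂ : ℂ) * l - a₁ +
            (b : ℂ) ^ 2 * ((l : ℂ) - z) * ((l : ℂ) - conj z) * τ l) := by
  obtain ⟨σ, hfin, hσ0, hσ, hφσ⟩ := hφ
  obtain ⟨μ, hμfin, hμ, h⟩ := exists_measure_inv_cauchyTransform hσ0 hσ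
  have hs0 : 0 < σ.real Set.univ := by
    have : NeZero σ := ⟨hσ0⟩
    exact measureReal_univ_pos
  set s : ℝ := σ.real Set.univ
  set m : ℝ := ∫ t, t ∂σ
  have hc := continuous_normSq_ofReal_sub_inv hz.ne'
  set w : ℝ → ℝ := fun t => (Complex.normSq ((t : ℂ) - z))⁻¹
  have hw0 (t : ℝ) : 0 ≤ w t := inv_nonneg.mpr (Complex.normSq_nonneg _)
  have hν (l : ℂ) : ∫ t : ℝ, 1 / ((t : ℂ) - l) ∂(μ.withDensity fun t => ENNReal.ofReal (w t)) =
      ∫ t : ℝ, (w t : ℂ) * (1 / ((t : ℂ) - l)) ∂μ := by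
    rw [integral_withDensity_eq_integral_toReal_smul (by fun_prop)
      (.of_forall fun _ => ENNReal.ofReal_lt_top)]
    refine integral_congr_ae (.of_forall fun t => ?_)
    simp only [ENNReal.toReal_ofReal (hw0 t), Complex.real_smul]
  have hνfin : IsFiniteMeasure (μ.withDensity fun t => ENNReal.ofReal (w t)) :=
    isFiniteMeasure_withDensity_ofReal
      (Integrable.of_continuousOn_Icc hμ hc.continuousOn).hasFiniteIntegral
  have hνsupp : μ.withDensity (fun t => ENNReal.ofReal (w t)) (Set.Icc α β)ᶜ = 0 :=
    withDensity_absolutelyContinuous _ _ hμ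
  set ν := μ.withDensity fun t => ENNReal.ofReal (w t)
  have hτ : (fun l : cutPlane α β => ∫ t : ℝ, 1 / ((t : ℂ) - (l : ℂ)) ∂ν) ∈ markovClassZero α β :=
    mem_markovClassZero_iff.mpr ⟨ν, hνfin, hνsupp, fun _ => rfl⟩
  have hsC : (s : ℂ) ≠ 0 := by exact_mod_cast hs0.ne'
  set A : ℝ := ∫ t : ℝ, w t ∂μ
  set B : ℝ := ∫ t : ℝ, (t - 2 * z.re) * w t ∂μ
  -- The constants come from dividing `(s + A) l - (m - B) + (l - z)(l - conj z) τ(l)` by `s²`.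
  have hD (l : cutPlane α β) :
      (((s + A) / s ^ 2 : ℝ) : ℂ) * l - ((m - B) / s ^ 2 : ℝ) +
        ((s⁻¹ : ℝ) : ℂ) ^ 2 * ((l : ℂ) - z) * ((l : ℂ) - conj z) *
          ∫ t : ℝ, 1 / ((t : ℂ) - (l : ℂ)) ∂ν ≠ 0 ∧
      φ l = -1 / ((((s + A) / s ^ 2 : ℝ) : ℂ) * l - ((m - B) / s ^ 2 : ℝ) +
        ((s⁻¹ : ℝ) : ℂ) ^ 2 * ((l : ℂ) - z) * ((l : ℂ) - conj z) *
          ∫ t : ℝ, 1 / ((t : ℂ) - (l : ℂ)) ∂ν) := by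
    obtain ⟨-, hl⟩ := h l l.2
    have hi : _ = (A : ℂ) * l + B + (l - z) * (l - conj z) *
        ∫ t : ℝ, (w t : ℂ) * (1 / ((t : ℂ) - l)) ∂μ := cauchyTransform_interpolation hμ hz.ne' l.2
    rw [hi, ← hν] at hl
    rw [hφσ]
    generalize ∫ t : ℝ, 1 / ((t : ℂ) - l) ∂ν = N at hl ⊢
    generalize ∫ t : ℝ, 1 / ((t : ℂ) - l) ∂σ = S at hl ⊢
    have hmul {x y : ℂ} (hxy : y * x = -1) : y ≠ 0 ∧ x = -1 / y := by
      have hy : y ≠ 0 := by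
        rintro rfl
        simp at hxy
      exact ⟨hy, by rw [eq_div_iff hy, mul_comm, hxy]⟩
    apply hmul
    push_cast
    field_simp
    linear_combination hl
  refine ⟨(m - B) / s ^ 2, (s + A) / s ^ 2, s⁻¹, inv_pos.mpr hs0, _, ⟨hτ, hD⟩, ?_⟩
  · rintro τ' ⟨hτ', h'⟩
    -- At `z` and `conj z` the coefficient of `τ` vanishes, so the equation says nothing about `τ`
    -- there.
    refine markovClassZero_eq_of_eq_off_finite hτ' hτ (s := {z, conj z}) (by simp) fun l hl => ?_
    have e1 := (h' l).2.symm.trans (hD l).2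
    rw [div_eq_div_iff (h' l).1 (hD l).1] at e1
    have h1 : (l : ℂ) - z ≠ 0 := fun h0 => hl (Or.inl (sub_eq_zero.mp h0))
    have h2 : (l : ℂ) - conj z ≠ 0 := fun h0 => hl (Or.inr (sub_eq_zero.mp h0))
    have h3 : (((s⁻¹ : ℝ) : ℂ) ^ 2 * ((l : ℂ) - z) * ((l : ℂ) - conj z)) ≠ 0 :=
      mul_ne_zero (mul_ne_zero (pow_ne_zero 2 (by exact_mod_cast inv_ne_zero hs0.ne')) h1) h2
    refine mul_left_cancel₀ h3 ?_
    linear_combination e1
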